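/- Let FPC be inflationary fixed-point logic with counting. It has element variables, ranging over the domain of a finite structure with $n$ elements, and number variables, ranging over $\{0,\dots,n\}$, and relation variables each with a type in $\{\mathrm{elem},\mathrm{num}\}^m$ for some $m$. Formulas are built from atoms $R(\vec t)$ (with $R$ a relation symbol of the vocabulary or a relation variable), equalities of terms of the same sort and comparisons $s\le t$ of number terms by the Boolean connectives, quantifiers $\forall,\exists$ over both sorts of variables, and the inflationary fixed-point operator $[\mathbf{ifp}_{R,\vec x}\,\varphi](\vec t)$. Number terms are number variables and counting terms $\#_x\varphi$, which denote the number of elements $x$ that satisfy $\varphi$. All graphs are finite, simple and undirected. The spectrum of a graph is the multiset of roots, with multiplicity, of the characteristic polynomial of its adjacency matrix, and two graphs are co-spectral if they have the same spectrum. (1) There is an FPC formula $\phi(\lambda,\kappa_1,\kappa_2)$ over the vocabulary $\{E\}$ with three free number variables such that, for every graph $G$ with $n$ vertices and every $l\in\{0,\dots,n\}$, the relation $\{(i,j)\in\{0,\dots,n\}^2 : G\models\phi[l,i,j]\}$ is the binary encoding of the total number $k$ of closed walks of length $l$ in $G$: it consists of the pairs $(i,j)$ for which the binary digit of $k$ at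 position $i(n+1)+j$ (the rank of $(i,j)$ in the lexicographic order, with positions counted from $0$, the least significant digit) is $1$, and every position at which $k$ has the digit $1$ arises from such a pair. (2) There is an FPC sentence $\mathrm{cospec}$ over the vocabulary $\{E,E'\}$ with two binary relation symbols such that, for every finite set $V$ and all graphs $(V,E)$ and $(V,E')$ on $V$, $$(V,E,E')\models \mathrm{cospec}\quad\Longleftrightarrow\quad (V,E)\text{ and }(V,E')\text{ are co-spectral.}$$ -/

import Mathlib

/-! ## Inflationary fixed-point logic with counting (FPC)

The syntax is well-scoped and well-sorted: variables are de Bruijn indices into a context, so that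
every formula carries the list of sorts of its free first-order variables and the list of types of
its free relation variables. -/

namespace FPC

/-- The two sorts of first-order variables: element variables and number variables. -/
inductive Srt : Type
  | elem : Srt
  | num : Srt

/-- `Var Γ s` is the type of positions in the list `Γ` that hold the entry `s`, that is, of the
variables of kind `s` in the context `Γ`. -/
inductive Var {κ : Type} : List κ → κ → Type
  | zero {s : κ} {Γ : List κ} : Var (s :: Γ) s
  | succ {s s' : κ} {Γ : List κ} : Var Γ s → Var (s' :: Γ) s

mutual

/-- Terms of sort `s` over the vocabulary `L`. `Γ` lists the sorts of the free first-order
variables, `Δ` the types of the free relation variables. Element terms are element variables and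
constant symbols; number terms are number variables and counting terms. -/
inductive Term (L : FirstOrder.Language.{0, 0}) : List Srt → List (List Srt) → Srt → Type
  | var {Γ : List Srt} {Δ : List (List Srt)} {s : Srt} : Var Γ s → Term L Γ Δ s
  | const {Γ : List Srt} {Δ : List (List Srt)} : L.Constants → Term L Γ Δ Srt.elem
  /-- The counting term `#x φ`, where the element variable `x` is bound. -/
  | count {Γ : List Srt} {Δ : List (List Srt)} :
      Formula L (Srt.elem :: Γ) Δ → Term L Γ Δ Srt.num

/-- Tuples of terms, of the sorts listed in the last argument. -/
inductive Terms (L : FirstOrder.Language.{0, 0}) : List Srt → List (List Srt) → List Srt → Type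
  | nil {Γ : List Srt} {Δ : List (List Srt)} : Terms L Γ Δ []
  | cons {Γ : List Srt} {Δ : List (List Srt)} {s : Srt} {t : List Srt} :
      Term L Γ Δ s → Terms L Γ Δ t → Terms L Γ Δ (s :: t)

/-- Formulas of FPC over the vocabulary `L`. -/
inductive Formula (L : FirstOrder.Language.{0, 0}) : List Srt → List (List Srt) → Type
  /-- An atom `R(t₁, …, tₖ)` with a relation symbol of the vocabulary. -/
  | rel {Γ : List Srt} {Δ : List (List Srt)} {k : ℕ} :
      L.Relations k → (Fin k → Term L Γ Δ Srt.elem) → Formula L Γ Δ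
  /-- An atom `X(t₁, …, tₘ)` with a relation variable of type `t`. -/
  | relVar {Γ : List Srt} {Δ : List (List Srt)} {t : List Srt} :
      Var Δ t → Terms L Γ Δ t → Formula L Γ Δ
  /-- Equality of two terms of the same sort. -/
  | eq {Γ : List Srt} {Δ : List (List Srt)} {s : Srt} :
      Term L Γ Δ s → Term L Γ Δ s → Formula L Γ Δ
  /-- Comparison of two number terms. -/
  | le {Γ : List Srt} {Δ : List (List Srt)} :
      Term L Γ Δ Srt.num → Term L Γ Δ Srt.num → Formula L Γ Δ
  | neg {Γ : List Srt} {Δ : List (List Srt)} : Formula L Γ Δ → Formula L Γ Δ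
  | and {Γ : List Srt} {Δ : List (List Srt)} : Formula L Γ Δ → Formula L Γ Δ → Formula L Γ Δ
  | or {Γ : List Srt} {Δ : List (List Srt)} : Formula L Γ Δ → Formula L Γ Δ → Formula L Γ Δ
  /-- Universal quantification over a variable of sort `s`. -/
  | all {Γ : List Srt} {Δ : List (List Srt)} (s : Srt) : Formula L (s :: Γ) Δ → Formula L Γ Δ
  /-- Existential quantification over a variable of sort `s`. -/
  | ex {Γ : List Srt} {Δ : List (List Srt)} (s : Srt) : Formula L (s :: Γ) Δ → Formula L Γ Δ
  /-- `[ifp_{X, x₁ … xₘ} φ](t₁, …, tₘ)`, where the relation variable `X` of type `t` and the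
  variables `x₁, …, xₘ` of the corresponding sorts are bound in `φ`. Other free variables of `φ`
  are parameters. -/
  | ifp {Γ : List Srt} {Δ : List (List Srt)} (t : List Srt) :
      Formula L (t ++ Γ) (t :: Δ) → Terms L Γ Δ t → Formula L Γ Δ

end

/-- A sentence has no free variables of any kind. -/
abbrev Sentence (L : FirstOrder.Language.{0, 0}) : Type := Formula L [] []

/-- The range of the variables of a sort in a structure with domain `V`: elements of `V`, or numbers
in `{0, …, n}`, where `n` is the size of `V`. -/
abbrev Dom (V : Type) : Srt → Type
  | Srt.elem => V
  | Srt.num => Fin (Nat.card V + 1)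

/-- Assignments of values to the variables of a context (equivalently, tuples of values of the listed
sorts). -/
inductive Env (V : Type) : List Srt → Type
  | nil : Env V []
  | cons {s : Srt} {Γ : List Srt} : Dom V s → Env V Γ → Env V (s :: Γ)

/-- The value of a variable. -/
def Env.get {V : Type} : {Γ : List Srt} → {s : Srt} → Env V Γ → Var Γ s → Dom V s
  | _, _, .cons a _, .zero => a
  | _, _, .cons _ e, .succ x => e.get x

/-- Concatenation of assignments. -/
def Env.append {V : Type} : {t Γ : List Srt} → Env V t → Env V Γ → Env V (t ++ Γ)
  | _, _, .nil, e => e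
  | _, _, .cons a d, e => .cons a (d.append e)

/-- Assignments of relations to relation variables. -/
inductive RelEnv (V : Type) : List (List Srt) → Type
  | nil : RelEnv V []
  | cons {t : List Srt} {Δ : List (List Srt)} :
      (Env V t → Prop) → RelEnv V Δ → RelEnv V (t :: Δ)

/-- The value of a relation variable. -/
def RelEnv.get {V : Type} : {Δ : List (List Srt)} → {t : List Srt} →
    RelEnv V Δ → Var Δ t → (Env V t → Prop)
  | _, _, .cons R _, .zero => R
  | _, _, .cons _ r, .succ X => r.get X

/-- The stages of the inflationary induction of an operator on relations:
`X₀ = ∅` and `Xᵢ₊₁ = Xᵢ ∪ F(Xᵢ)`. -/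
def ifpStage {α : Type} (F : (α → Prop) → α → Prop) : ℕ → α → Prop
  | 0 => fun _ => False
  | i + 1 => fun x => ifpStage F i x ∨ F (ifpStage F i) x

/-- The inflationary fixed point of an operator on the relations on a finite set: the union of the
(increasing, hence eventually constant) sequence of stages. -/
def inflFix {α : Type} (F : (α → Prop) → α → Prop) (x : α) : Prop :=
  ∃ i : ℕ, ifpStage F i x

/-- The number of elements of a finite set `V` that satisfy `P`, as a member of the number
domain. -/
noncomputable def countNum {V : Type} [Finite V] (P : V → Prop) : Fin (Nat.card V + 1) :=
  ⟨Nat.card {v : V // P v}, Nat.lt_succ_of_le (Finite.card_subtype_le P)⟩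

mutual

/-- The value of a term. -/
noncomputable def Term.value {L : FirstOrder.Language.{0, 0}} {V : Type} [L.Structure V] [Finite V] :
    {Γ : List Srt} → {Δ : List (List Srt)} → {s : Srt} →
      Term L Γ Δ s → Env V Γ → RelEnv V Δ → Dom V s
  | _, _, _, .var x, e, _ => e.get x
  | _, _, _, .const c, _, _ => (c : V)
  | _, _, _, .count φ, e, r => countNum fun v : V => φ.Realize (.cons (s := Srt.elem) v e) r

/-- The value of a tuple of terms. -/
noncomputable def Terms.value {L : FirstOrder.Language.{0, 0}} {V : Type} [L.Structure V] [Finite V] :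
    {Γ : List Srt} → {Δ : List (List Srt)} → {t : List Srt} →
      Terms L Γ Δ t → Env V Γ → RelEnv V Δ → Env V t
  | _, _, _, .nil, _, _ => .nil
  | _, _, _, .cons a as, e, r => .cons (a.value e r) (as.value e r)

/-- Satisfaction of a formula of FPC in a finite structure. -/
noncomputable def Formula.Realize {L : FirstOrder.Language.{0, 0}} {V : Type} [L.Structure V] [Finite V] :
    {Γ : List Srt} → {Δ : List (List Srt)} → Formula L Γ Δ → Env V Γ → RelEnv V Δ → Prop
  | _, _, .rel R ts, e, r => FirstOrder.Language.Structure.RelMap R fun i => ((ts i).value e r : V)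
  | _, _, .relVar X ts, e, r => r.get X (ts.value e r)
  | _, _, .eq a b, e, r => a.value e r = b.value e r
  | _, _, .le a b, e, r =>
      (a.value e r : Fin (Nat.card V + 1)) ≤ (b.value e r : Fin (Nat.card V + 1))
  | _, _, .neg φ, e, r => ¬ φ.Realize e r
  | _, _, .and φ ψ, e, r => φ.Realize e r ∧ ψ.Realize e r
  | _, _, .or φ ψ, e, r => φ.Realize e r ∨ ψ.Realize e r
  | _, _, .all s φ, e, r => ∀ a : Dom V s, φ.Realize (.cons a e) r
  | _, _, .ex s φ, e, r => ∃ a : Dom V s, φ.Realize (.cons a e) r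
  | _, _, .ifp _ φ ts, e, r =>
      inflFix (fun X x => φ.Realize (x.append e) (.cons X r)) (ts.value e r)

end

/-! ## Vocabularies and structures -/

/-- The relation symbols `E` and `E'`, both binary. -/
inductive GraphPairRel : ℕ → Type
  | E : GraphPairRel 2
  | E' : GraphPairRel 2

/-- The vocabulary `{E, E'}` (no function or constant symbols). -/
abbrev graphPairLanguage : FirstOrder.Language.{0, 0} := ⟨fun _ => Empty, GraphPairRel⟩

/-- The structure `(V, E, E')` in which `E` is the adjacency of `G` and `E'` that of `G'`. -/
@[reducible]
def graphPairStructure {V : Type} (G G' : SimpleGraph V) : graphPairLanguage.Structure V where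
  funMap := fun f => nomatch f
  RelMap := fun R x => match R with
    | .E => G.Adj (x 0) (x 1)
    | .E' => G'.Adj (x 0) (x 1)

/-- `(V, E, E') ⊨ σ`, for a sentence `σ` over `{E, E'}`. -/
def HoldsInPair {V : Type} [Finite V] (σ : Sentence graphPairLanguage) (G G' : SimpleGraph V) :
    Prop :=
  letI := graphPairStructure G G'
  σ.Realize (V := V) .nil .nil

/-- `(V, E) ⊨ φ[l, i, j]`, for a formula `φ(λ, κ₁, κ₂)` over `{E}` with three free number
variables. -/
def HoldsInGraph {V : Type} [Finite V]
    (φ : Formula FirstOrder.Language.graph [Srt.num, Srt.num, Srt.num] []) (G : SimpleGraph V)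
    (l i j : Fin (Nat.card V + 1)) : Prop :=
  letI := G.structure
  φ.Realize (V := V) (.cons (s := Srt.num) l
    (.cons (s := Srt.num) i (.cons (s := Srt.num) j .nil))) .nil

/-! ## Spectra and closed walks -/

open Classical in
/-- The spectrum of a finite graph: the multiset of roots, with multiplicity, of the characteristic
polynomial of its adjacency matrix, a real symmetric matrix. -/
noncomputable def graphSpectrum {V : Type} [Fintype V] (G : SimpleGraph V) : Multiset ℝ :=
  (G.adjMatrix ℝ).charpoly.roots

/-- Two graphs are co-spectral if they have the same spectrum. -/
def Cospectral {V W : Type} [Fintype V] [Fintype W] (G : SimpleGraph V) (H : SimpleGraph W) :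
    Prop :=
  graphSpectrum G = graphSpectrum H

/-- The total number of closed walks of length `l`, over all starting vertices. -/
noncomputable def closedWalkCount {V : Type} (G : SimpleGraph V) (l : ℕ) : ℕ :=
  Nat.card (Σ v : V, {p : G.Walk v v // p.length = l})

/-- The binary relation `K` on `{0, …, n}` encodes the number `k` in binary: the pair `(i, j)`
stands for its rank `i * (n + 1) + j` in the lexicographic order (counted from 0), and `K` consists
of the pairs that stand for the positions of the digits 1 of `k`. -/
def BinaryEncodes {n : ℕ} (K : Fin (n + 1) → Fin (n + 1) → Prop) (k : ℕ) : Prop :=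
  ∀ b : ℕ, k.testBit b = true ↔
    ∃ i j : Fin (n + 1), b = (i : ℕ) * (n + 1) + (j : ℕ) ∧ K i j

end FPC

/-!
**Counting closed walks.** The number of walks of length `l + 1` from `x` to `y` is the sum, over
the neighbours `z` of `x`, of the numbers of walks of length `l` from `z` to `y`; the number of
closed walks is a sum over all vertices as well. The difficulty is to add a family of large binary
numbers `f z` whose index set has no definable order. Column addition does it: the number of `z`
for which `f z` has a `1` in a given column is a counting term, and the carry into a column never
exceeds the number `n` of vertices (`FPC.carry_le`), so it is a member of the number domain. An
induction over the columns then defines the digits of the sum (`FPC.Formula.realize_sumDigit`), and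
an outer induction over `l` the digits of the numbers of walks (`FPC.Formula.realize_walkRel`).
There are enough positions, because there are at most `n ^ (n + 1) < 2 ^ ((n + 1) * (n + 1))` closed
walks of a length `l ≤ n` (`FPC.closedWalkCount_lt`).

Each of the inductions adds, in one stage, exactly the tuples of the next rank of the relation that
it defines, and one lemma on inflationary fixed points (`FPC.inflFix_iff_of_rank`) covers them all.
The formulas are polymorphic in the context, so that they can be nested without any renaming of
variables.

**Co-spectrality.** The number of closed walks of length `l` is the trace of the `l`-th power of the
adjacency matrix, that is, the `l`-th power sum of the eigenvalues. By Newton's identities, the power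
sums of exponent at most `n` determine the elementary symmetric functions of `n` eigenvalues and
hence the spectrum (`Matrix.IsHermitian.roots_charpoly_eq_iff`). So two graphs are co-spectral if and only
if, for all `l ≤ n`, their numbers of closed walks of length `l` have the same binary digits.
-/

/-! ### Power sums of eigenvalues -/

open Matrix in
theorem Matrix.IsHermitian.trace_pow_eq_sum_eigenvalues_pow {n : Type*} [Fintype n] [DecidableEq n]
    {A : Matrix n n ℝ} (hA : A.IsHermitian) (k : ℕ) :
    (A ^ k).trace = ∑ i, hA.eigenvalues i ^ k := by
  have h : A ^ k = Unitary.conjStarAlgAut ℝ _ hA.eigenvectorUnitary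
      (diagonal (hA.eigenvalues ^ k)) := by
    conv_lhs => rw [hA.spectral_theorem]
    rw [← map_pow, diagonal_pow]
    rfl
  rw [h, Unitary.conjStarAlgAut_apply, trace_mul_comm, ← mul_assoc]
  simp [trace_diagonal]

open MvPolynomial in
/-- By Newton's identities, power sums determine elementary symmetric functions. -/
theorem aeval_esymm_eq_of_sum_pow_eq {σ : Type*} [Fintype σ] (a b : σ → ℝ) (n : ℕ)
    (h : ∀ k ≤ n, ∑ i, a i ^ k = ∑ i, b i ^ k) :
    ∀ k ≤ n, aeval a (esymm σ ℝ k) = aeval b (esymm σ ℝ k) := by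
  intro k
  induction k using Nat.strong_induction_on with
  | _ k ih =>
    intro hk
    rcases Nat.eq_zero_or_pos k with rfl | hpos
    · simp
    have key : ∀ c : σ → ℝ, (k : ℝ) * aeval c (esymm σ ℝ k) = (-1) ^ (k + 1) *
        ∑ p ∈ Finset.HasAntidiagonal.antidiagonal k with p.1 < k,
          (-1) ^ p.1 * aeval c (esymm σ ℝ p.1) * ∑ i, c i ^ p.2 := fun c => by
      simpa [psum] using congrArg (aeval c) (mul_esymm_eq_sum σ ℝ k)
    have hk0 : (k : ℝ) ≠ 0 := by positivity
    refine mul_left_cancel₀ hk0 ?_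
    rw [key a, key b]
    congr 1
    refine Finset.sum_congr rfl fun p hp => ?_
    rw [Finset.mem_filter, Finset.HasAntidiagonal.mem_antidiagonal] at hp
    rw [ih p.1 hp.2 (by omega), h p.2 (by omega)]

open MvPolynomial in
theorem multiset_map_eq_of_sum_pow_eq {σ : Type*} [Fintype σ] (a b : σ → ℝ)
    (h : ∀ k ≤ Fintype.card σ, ∑ i, a i ^ k = ∑ i, b i ^ k) :
    Finset.univ.val.map a = Finset.univ.val.map b := by
  have key : ((Finset.univ.val.map a).map fun t => Polynomial.X - Polynomial.C t).prod =
      ((Finset.univ.val.map b).map fun t => Polynomial.X - Polynomial.C t).prod := by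
    rw [Multiset.prod_X_sub_X_eq_sum_esymm, Multiset.prod_X_sub_X_eq_sum_esymm]
    simp only [Multiset.card_map]
    refine Finset.sum_congr rfl fun j hj => ?_
    have hj' : j ≤ Fintype.card σ := by
      have : j < Fintype.card σ + 1 := by simpa using hj
      omega
    have := aeval_esymm_eq_of_sum_pow_eq a b _ h j hj'
    rw [aeval_esymm_eq_multiset_esymm, aeval_esymm_eq_multiset_esymm] at this
    rw [this]
  rw [← Polynomial.roots_multiset_prod_X_sub_C (Finset.univ.val.map a), key,
    Polynomial.roots_multiset_prod_X_sub_C]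

theorem Matrix.IsHermitian.roots_charpoly_eq_iff {n : Type*} [Fintype n] [DecidableEq n]
    {A B : Matrix n n ℝ} (hA : A.IsHermitian) (hB : B.IsHermitian) :
    A.charpoly.roots = B.charpoly.roots ↔
      ∀ k ≤ Fintype.card n, (A ^ k).trace = (B ^ k).trace := by
  simp only [hA.trace_pow_eq_sum_eigenvalues_pow, hB.trace_pow_eq_sum_eigenvalues_pow]
  rw [hA.roots_charpoly_eq_eigenvalues, hB.roots_charpoly_eq_eigenvalues]
  refine ⟨fun h k _ => ?_, fun h => multiset_map_eq_of_sum_pow_eq _ _ h⟩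
  simpa using congrArg (fun s : Multiset ℝ => (s.map (· ^ k)).sum) h

/-! ### Numbers of walks -/

namespace FPC

open Classical in
/-- The number of walks of length `l` from `x` to `y`. -/
noncomputable def walkCount {V : Type} [Fintype V] (G : SimpleGraph V) (l : ℕ) (x y : V) : ℕ :=
  (G.adjMatrix ℕ ^ l) x y

section
variable {V : Type} [Fintype V] (G : SimpleGraph V)

open Classical in
theorem closedWalkCount_eq_sum (l : ℕ) : closedWalkCount G l = ∑ x, walkCount G l x x := by
  rw [closedWalkCount, Nat.card_sigma]
  refine Finset.sum_congr rfl fun x _ => ?_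
  rw [walkCount, SimpleGraph.adjMatrix_pow_apply_eq_card_walk, Nat.cast_id, Nat.card_eq_fintype_card]
  rfl

open Classical in
theorem closedWalkCount_eq_trace (l : ℕ) :
    (closedWalkCount G l : ℝ) = (G.adjMatrix ℝ ^ l).trace := by
  rw [closedWalkCount_eq_sum, Matrix.trace, Nat.cast_sum]
  refine Finset.sum_congr rfl fun x _ => ?_
  rw [walkCount, Matrix.diag_apply, SimpleGraph.adjMatrix_pow_apply_eq_card_walk,
    SimpleGraph.adjMatrix_pow_apply_eq_card_walk, Nat.cast_id]

theorem cospectral_iff_closedWalkCount_eq (G' : SimpleGraph V) :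
    Cospectral G G' ↔ ∀ l ≤ Nat.card V, closedWalkCount G l = closedWalkCount G' l := by
  classical
  rw [Cospectral, graphSpectrum, graphSpectrum, Matrix.IsHermitian.roots_charpoly_eq_iff
    (by simp [Matrix.IsHermitian])
    (by simp [Matrix.IsHermitian]), Nat.card_eq_fintype_card]
  refine forall₂_congr fun l _ => ?_
  rw [← closedWalkCount_eq_trace, ← closedWalkCount_eq_trace, Nat.cast_inj]

open Classical in
theorem walkCount_zero (x y : V) : walkCount G 0 x y = if x = y then 1 else 0 := by
  simp [walkCount, Matrix.one_apply]

open Classical in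
theorem walkCount_succ (l : ℕ) (x y : V) :
    walkCount G (l + 1) x y = ∑ z, if G.Adj x z then walkCount G l z y else 0 := by
  simp [walkCount, pow_succ', Matrix.mul_apply, SimpleGraph.adjMatrix_apply]

theorem walkCount_le (l : ℕ) (x y : V) : walkCount G l x y ≤ Nat.card V ^ l := by
  induction l generalizing x with
  | zero => rw [walkCount_zero]; split <;> simp
  | succ l ih =>
    rw [walkCount_succ, pow_succ', Nat.card_eq_fintype_card]
    refine (Finset.sum_le_card_nsmul _ _ (Nat.card V ^ l) fun z _ => ?_).trans (by simp)
    split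
    · exact ih z
    · exact Nat.zero_le _

theorem closedWalkCount_lt {l : ℕ} (hl : l ≤ Nat.card V) :
    closedWalkCount G l < 2 ^ ((Nat.card V + 1) * (Nat.card V + 1)) := by
  have h1 : closedWalkCount G l ≤ Nat.card V * Nat.card V ^ l := by
    rw [closedWalkCount_eq_sum]
    exact (Finset.sum_le_card_nsmul _ _ _ fun x _ => walkCount_le G l x x).trans (by simp)
  generalize Nat.card V = n at *
  calc closedWalkCount G l ≤ n ^ (l + 1) := by rwa [pow_succ']
    _ ≤ (n + 1) ^ (l + 1) := Nat.pow_le_pow_left (Nat.le_succ n) _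
    _ ≤ (n + 1) ^ (n + 1) := Nat.pow_le_pow_right (Nat.succ_pos n) (by omega)
    _ < (2 ^ (n + 1)) ^ (n + 1) := Nat.pow_lt_pow_left Nat.lt_two_pow_self (Nat.succ_ne_zero n)
    _ = 2 ^ ((n + 1) * (n + 1)) := (pow_mul _ _ _).symm

end

/-! ### Column addition -/

section
variable {V : Type} [Fintype V] (f : V → ℕ)

/-- The carry into position `p` in the column addition of all the numbers `f z`. -/
def carry (p : ℕ) : ℕ := (∑ z, f z % 2 ^ p) / 2 ^ p

/-- The number of digits `1` in column `p` of the addition of all the numbers `f z`. -/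
noncomputable def column (p : ℕ) : ℕ := Nat.card {z // (f z).testBit p = true}

theorem carry_zero : carry f 0 = 0 := by simp [carry, Nat.mod_one]

theorem carry_le (p : ℕ) : carry f p ≤ Nat.card V := by
  rw [carry, Nat.card_eq_fintype_card]
  refine Nat.div_le_of_le_mul ?_
  refine (Finset.sum_le_card_nsmul _ _ (2 ^ p) fun z _ => (Nat.mod_lt _ (by positivity)).le).trans ?_
  simp [mul_comm]

theorem sum_mod_two_pow_succ (p : ℕ) :
    ∑ z, f z % 2 ^ (p + 1) = ∑ z, f z % 2 ^ p + 2 ^ p * column f p := by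
  have h : column f p = ∑ z, f z / 2 ^ p % 2 := by
    rw [column, Nat.card_eq_fintype_card, Fintype.card_subtype, Finset.card_filter]
    refine Finset.sum_congr rfl fun z _ => ?_
    rw [Nat.testBit_eq_decide_div_mod_eq]
    have := Nat.mod_two_eq_zero_or_one (f z / 2 ^ p)
    rcases this with h | h <;> simp [h]
  rw [h, Finset.mul_sum, ← Finset.sum_add_distrib]
  exact Finset.sum_congr rfl fun z _ => Nat.mod_pow_succ

theorem carry_succ (p : ℕ) : carry f (p + 1) = (column f p + carry f p) / 2 := by
  rw [carry, sum_mod_two_pow_succ, pow_succ, ← Nat.div_div_eq_div_mul,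
    Nat.add_mul_div_left _ _ (by positivity), add_comm, carry]

/-- The sum of a column and its carry determines the digit of the total in that column. -/
theorem testBit_sum (p : ℕ) :
    (∑ z, f z).testBit p = true ↔ (column f p + carry f p) % 2 = 1 := by
  have h : (∑ z, f z) % 2 ^ (p + 1) = (∑ z, f z % 2 ^ p + 2 ^ p * column f p) % 2 ^ (p + 1) := by
    rw [← sum_mod_two_pow_succ, Finset.sum_nat_mod]
  rw [Nat.testBit_eq_decide_div_mod_eq, decide_eq_true_iff, ← Nat.mod_mul_right_div_self,
    ← pow_succ, h, pow_succ, Nat.mod_mul_right_div_self, Nat.add_mul_div_left _ _ (by positivity),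
    add_comm, carry]

end

/-! ### Inflationary fixed points -/

theorem ifpStage_iff_of_rank {α : Type} {F : (α → Prop) → α → Prop} {P : α → Prop} {rank : α → ℕ}
    (h : ∀ s X, (∀ x, X x ↔ P x ∧ rank x < s) → ∀ x, F X x ↔ P x ∧ rank x ≤ s) (s : ℕ) (x : α) :
    ifpStage F s x ↔ P x ∧ rank x < s := by
  induction s generalizing x with
  | zero => simp [ifpStage]
  | succ s ih =>
    simp only [ifpStage, h s _ ih, ih]
    exact ⟨fun hx => hx.elim (fun hx => ⟨hx.1, by omega⟩) fun hx => ⟨hx.1, by omega⟩,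
      fun hx => .inr ⟨hx.1, by omega⟩⟩

/-- An operator that derives from the members of `P` of rank below `s` exactly those of rank at
most `s` has the inflationary fixed point `P`. Every fixed point below is computed in this way. -/
theorem inflFix_iff_of_rank {α : Type} {F : (α → Prop) → α → Prop} {P : α → Prop} (rank : α → ℕ)
    (h : ∀ s X, (∀ x, X x ↔ P x ∧ rank x < s) → ∀ x, F X x ↔ P x ∧ rank x ≤ s) (x : α) :
    inflFix F x ↔ P x := by
  simp only [inflFix, ifpStage_iff_of_rank h]
  exact ⟨fun ⟨_, hx⟩ => hx.1, fun hx => ⟨rank x + 1, hx, Nat.lt_succ_self _⟩⟩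

/-! ### Evaluation of variables -/

/-- The value of a number variable, as a natural number. -/
def Env.val {V : Type} {Γ : List Srt} (e : Env V Γ) (x : Var Γ .num) : ℕ :=
  (e.get x : Fin (Nat.card V + 1)).val

/-- The position in a binary representation for which a pair of numbers stands. -/
noncomputable def Env.pos {V : Type} {Γ : List Srt} (e : Env V Γ) (i j : Var Γ .num) : ℕ :=
  e.val i * (Nat.card V + 1) + e.val j

section Env

variable {V : Type} {Γ t : List Srt} {s : Srt}

@[simp] theorem Env.get_zero (a : Dom V s) (e : Env V Γ) : (Env.cons a e).get .zero = a := rfl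

@[simp] theorem Env.get_succ {s' : Srt} (a : Dom V s') (e : Env V Γ) (x : Var Γ s) :
    (Env.cons a e).get x.succ = e.get x := rfl

@[simp] theorem Env.val_zero (a : Dom V .num) (e : Env V Γ) :
    (Env.cons a e).val .zero = (show Fin (Nat.card V + 1) from a).val := rfl

@[simp] theorem Env.val_succ (a : Dom V s) (e : Env V Γ) (x : Var Γ .num) :
    (Env.cons a e).val x.succ = e.val x := rfl

theorem Env.val_le (e : Env V Γ) (x : Var Γ .num) : e.val x ≤ Nat.card V :=
  Nat.le_of_lt_succ (e.get x : Fin (Nat.card V + 1)).isLt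

@[simp] theorem Env.nil_append (e : Env V Γ) : Env.nil.append e = e := rfl

@[simp] theorem Env.cons_append (a : Dom V s) (d : Env V t) (e : Env V Γ) :
    (Env.cons a d).append e = .cons a (d.append e) := rfl

@[simp] theorem RelEnv.get_zero {Δ : List (List Srt)} (R : Env V t → Prop) (r : RelEnv V Δ) :
    (RelEnv.cons R r).get .zero = R := rfl

@[simp] theorem RelEnv.get_succ {Δ : List (List Srt)} {t' : List Srt} (R : Env V t → Prop)
    (r : RelEnv V Δ) (X : Var Δ t') : (RelEnv.cons R r).get X.succ = r.get X := rfl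

theorem exists_num_iff {p : Dom V .num → Prop} :
    (∃ a, p a) ↔ ∃ (k : ℕ) (h : k < Nat.card V + 1), p (⟨k, h⟩ : Fin (Nat.card V + 1)) :=
  Fin.exists_iff

theorem forall_num_iff {p : Dom V .num → Prop} :
    (∀ a, p a) ↔ ∀ (k : ℕ) (h : k < Nat.card V + 1), p (⟨k, h⟩ : Fin (Nat.card V + 1)) :=
  Fin.forall_iff

@[simp] theorem Term.value_var {L : FirstOrder.Language.{0, 0}} [L.Structure V] [Finite V]
    {Δ : List (List Srt)} (x : Var Γ s) (e : Env V Γ) (r : RelEnv V Δ) :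
    (Term.var (L := L) x).value e r = e.get x := by
  simp [Term.value]

theorem Env.get_eq_iff (e : Env V Γ) (x y : Var Γ .num) : e.get x = e.get y ↔ e.val x = e.val y :=
  Fin.ext_iff

end Env

-- The variables of a context, counted from its head: the innermost bound variable is `v₀`.
local notation "v₀" => Var.zero
local notation "v₁" => Var.succ v₀
local notation "v₂" => Var.succ v₁
local notation "v₃" => Var.succ v₂
local notation "v₄" => Var.succ v₃
local notation "v₅" => Var.succ v₄
local notation "v₆" => Var.succ v₅
local notation "v₇" => Var.succ v₆
local notation "v₈" => Var.succ v₇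
local notation "v₉" => Var.succ v₈

namespace Formula

variable {L : FirstOrder.Language.{0, 0}} {Γ : List Srt} {Δ : List (List Srt)}

/-! ### Arithmetic on the number domain -/

/-- `x = y` for variables. -/
def varEq {s : Srt} (x y : Var Γ s) : Formula L Γ Δ := .eq (.var x) (.var y)

/-- `x = 0`. -/
def isZero (x : Var Γ .num) : Formula L Γ Δ := .all .num (.le (.var x.succ) (.var v₀))

/-- `x = n`. -/
def isMax (x : Var Γ .num) : Formula L Γ Δ := .all .num (.le (.var v₀) (.var x.succ))

/-- `y = x + 1`. -/
def isSucc (x y : Var Γ .num) : Formula L Γ Δ :=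
  .and (.neg (.le (.var y) (.var x)))
    (.all .num (.or (.le (.var v₀) (.var x.succ)) (.le (.var y.succ) (.var v₀))))

/-- The pair `(i', j')` is the successor of `(i, j)` in the lexicographic order. -/
def isNext (i j i' j' : Var Γ .num) : Formula L Γ Δ :=
  .or (.and (varEq i i') (isSucc j j')) (.and (isSucc i i') (.and (isMax j) (isZero j')))

section Realize

variable {V : Type} [L.Structure V] [Finite V] (e : Env V Γ) (r : RelEnv V Δ)

theorem realize_le (x y : Var Γ .num) :
    (Formula.le (L := L) (.var x) (.var y)).Realize e r ↔ e.val x ≤ e.val y := by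
  simp only [Realize, Term.value]
  exact Iff.rfl

@[simp] theorem realize_and (φ ψ : Formula L Γ Δ) :
    (φ.and ψ).Realize e r ↔ φ.Realize e r ∧ ψ.Realize e r := by simp [Realize]

@[simp] theorem realize_or (φ ψ : Formula L Γ Δ) :
    (φ.or ψ).Realize e r ↔ φ.Realize e r ∨ ψ.Realize e r := by simp [Realize]

@[simp] theorem realize_neg (φ : Formula L Γ Δ) : φ.neg.Realize e r ↔ ¬ φ.Realize e r := by
  simp [Realize]

theorem realize_all_num (φ : Formula L (.num :: Γ) Δ) :
    (φ.all .num).Realize e r ↔ ∀ (k : ℕ) (h : k < Nat.card V + 1),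
      φ.Realize (.cons (s := .num) (⟨k, h⟩ : Fin (Nat.card V + 1)) e) r := by
  rw [← forall_num_iff (p := fun a => φ.Realize (.cons a e) r)]
  simp [Realize]

theorem realize_ex_num (φ : Formula L (.num :: Γ) Δ) :
    (φ.ex .num).Realize e r ↔ ∃ (k : ℕ) (h : k < Nat.card V + 1),
      φ.Realize (.cons (s := .num) (⟨k, h⟩ : Fin (Nat.card V + 1)) e) r := by
  rw [← exists_num_iff (p := fun a => φ.Realize (.cons a e) r)]
  simp [Realize]

@[simp] theorem realize_varEq_num (x y : Var Γ .num) :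
    (varEq (L := L) x y).Realize e r ↔ e.val x = e.val y := by
  rw [← Env.get_eq_iff]
  simp [varEq, Realize, Term.value]

@[simp] theorem realize_varEq_elem (x y : Var Γ .elem) :
    (varEq (L := L) x y).Realize e r ↔ e.get x = e.get y := by
  simp [varEq, Realize, Term.value]

@[simp] theorem realize_isZero (x : Var Γ .num) :
    (isZero (L := L) x).Realize e r ↔ e.val x = 0 := by
  simp only [isZero, realize_all_num, realize_le, Env.val_succ, Env.val_zero]
  exact ⟨fun h => Nat.le_zero.1 (h 0 (Nat.succ_pos _)), fun h k _ => by omega⟩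

@[simp] theorem realize_isMax (x : Var Γ .num) :
    (isMax (L := L) x).Realize e r ↔ e.val x = Nat.card V := by
  have := e.val_le x
  simp only [isMax, realize_all_num, realize_le, Env.val_succ, Env.val_zero]
  exact ⟨fun h => le_antisymm this (h _ (Nat.lt_succ_self _)), fun h k _ => by omega⟩

@[simp] theorem realize_isSucc (x y : Var Γ .num) :
    (isSucc (L := L) x y).Realize e r ↔ e.val y = e.val x + 1 := by
  have := e.val_le y
  simp only [isSucc, realize_all_num, realize_and, realize_or, realize_neg, realize_le,
    Env.val_succ, Env.val_zero]
  refine ⟨fun ⟨h1, h2⟩ => ?_, fun h => ⟨by omega, fun k _ => by omega⟩⟩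
  have := h2 (e.val x + 1) (by omega)
  omega

@[simp] theorem realize_isNext (i j i' j' : Var Γ .num) :
    (isNext (L := L) i j i' j').Realize e r ↔ e.pos i' j' = e.pos i j + 1 := by
  have hj := e.val_le j
  have hj' := e.val_le j'
  simp only [isNext, realize_and, realize_or, realize_varEq_num, realize_isSucc, realize_isMax,
    realize_isZero, Env.pos]
  generalize Nat.card V = n at *
  generalize e.val i = a, e.val j = b, e.val i' = a', e.val j' = b' at *
  constructor
  · rintro (⟨rfl, rfl⟩ | ⟨rfl, rfl, rfl⟩) <;> ring
  · intro h
    rcases lt_trichotomy a a' with hlt | rfl | hlt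
    · obtain ⟨d, rfl⟩ := Nat.exists_eq_add_of_lt hlt
      have hd : d = 0 := by
        rcases Nat.eq_zero_or_pos d with h0 | h0
        · exact h0
        · nlinarith
      subst hd
      right
      refine ⟨rfl, ?_, ?_⟩ <;> nlinarith
    · left
      exact ⟨rfl, by omega⟩
    · obtain ⟨d, rfl⟩ := Nat.exists_eq_add_of_lt hlt
      nlinarith

end Realize

/-- `c + d = 2 * q + b` and `b ≤ 1`: the digit of the sum of `c` and `d` in its column, and what is
carried. The sum itself may lie outside the number domain, so the relation is built up by an
induction on `c + d`. -/
def halfSum (c d b q : Var Γ .num) : Formula L Γ Δ :=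
  .ifp [.num, .num, .num, .num]
    (.or (.and (.and (isZero v₀) (isZero v₁)) (.and (isZero v₂) (isZero v₃)))
      (.ex .num <| .ex .num <| .ex .num <| .ex .num <|
        .and (.relVar v₀ (.cons (.var v₀) (.cons (.var v₁) (.cons (.var v₂) (.cons (.var v₃) .nil)))))
          (.and
            (.or (.and (isSucc v₀ v₄) (varEq v₁ v₅)) (.and (varEq v₀ v₄) (isSucc v₁ v₅)))
            (.or (.and (isZero v₂) (.and (isSucc v₂ v₆) (varEq v₃ v₇)))
              (.and (isZero v₆) (.and (isSucc v₆ v₂) (isSucc v₃ v₇)))))))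
    (.cons (.var c) (.cons (.var d) (.cons (.var b) (.cons (.var q) .nil))))

@[simp] theorem realize_halfSum {V : Type} [L.Structure V] [Finite V] (e : Env V Γ)
    (r : RelEnv V Δ) (c d b q : Var Γ .num) :
    (halfSum (L := L) c d b q).Realize e r ↔
      e.val c + e.val d = 2 * e.val q + e.val b ∧ e.val b ≤ 1 := by
  simp only [halfSum]
  rw [Realize, inflFix_iff_of_rank
    (P := fun x => x.val v₀ + x.val v₁ = 2 * x.val v₃ + x.val v₂ ∧ x.val v₂ ≤ 1)
    (fun x => x.val v₀ + x.val v₁)]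
  · simp [Terms.value, Term.value, Env.val]
  · intro s X hX x
    rcases x with _ | ⟨c, _ | ⟨d, _ | ⟨b, _ | ⟨q, _ | _⟩⟩⟩⟩
    change Fin (Nat.card V + 1) at c d b q
    have hc := c.isLt
    have hd := d.isLt
    have hb := b.isLt
    have hq := q.isLt
    simp only [realize_or, realize_and, realize_ex_num, realize_isZero, realize_isSucc,
      realize_varEq_num, Env.cons_append, Env.nil_append, Env.val_zero, Env.val_succ]
    simp only [Realize, RelEnv.get_zero, Terms.value, Term.value, hX, Env.val_zero, Env.val_succ,
      Env.get_zero, Env.get_succ]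
    constructor
    · rintro (h | ⟨q', _, b', _, d', _, c', _, h⟩) <;> omega
    · rintro ⟨⟨h1, h2⟩, h3⟩
      rcases Nat.eq_zero_or_pos (c.val + d.val) with h0 | h0
      · exact .inl ⟨⟨by omega, by omega⟩, by omega, by omega⟩
      obtain ⟨c', d', hcd⟩ : ∃ c' d', c.val = c' + 1 ∧ d' = d.val ∨ c' = c.val ∧ d.val = d' + 1 := by
        rcases Nat.eq_zero_or_pos c.val with h | h
        · exact ⟨c, d - 1, by omega⟩
        · exact ⟨c - 1, d, by omega⟩
      obtain ⟨b', q', hbq⟩ : ∃ b' q', b' = 0 ∧ b.val = 1 ∧ q' = q.val ∨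
          b.val = 0 ∧ b' = 1 ∧ q.val = q' + 1 := by
        rcases Nat.eq_zero_or_pos b.val with h | h
        · exact ⟨1, q - 1, by omega⟩
        · exact ⟨0, q, by omega⟩
      exact .inr ⟨q', by omega, b', by omega, d', by omega, c', by omega, by omega⟩

/-! ### Sums of families of binary numbers -/

/-- Suppose that `ψ(z, p₁, p₂)` says that the digit at position `(p₁, p₂)` of a number `f z` is
`1`. Then `carryRel ψ i j b c` says that, in the column addition of all the numbers `f z`, the
digit at position `(i, j)` is `b` and the carry out of that position is `c`. In `ψ`, the variable
`z` is followed by two auxiliary variables, by `p₁` and `p₂`, and by two more auxiliary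
variables. -/
def carryRel (ψ : Formula L (.elem :: .num :: .num :: .num :: .num :: .num :: .num :: Γ)
    ([.num, .num, .num, .num] :: Δ)) (i j b c : Var Γ .num) : Formula L Γ Δ :=
  .ifp [.num, .num, .num, .num]
    (.ex .num <| .ex .num <| .and (.eq (.var v₀) (.count ψ)) <| .and (halfSum v₀ v₁ v₄ v₅) <|
      .or (.and (isZero v₂) (.and (isZero v₃) (isZero v₁)))
        (.ex .num <| .ex .num <| .ex .num <| .and (isNext v₀ v₁ v₅ v₆) <|
          .relVar v₀ (.cons (.var v₀) (.cons (.var v₁) (.cons (.var v₂) (.cons (.var v₄) .nil))))))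
    (.cons (.var i) (.cons (.var j) (.cons (.var b) (.cons (.var c) .nil))))

section
variable {V : Type} [L.Structure V] [Fintype V]

theorem realize_carryRel (e : Env V Γ)
    (r : RelEnv V Δ) (f : V → ℕ)
    (ψ : Formula L (.elem :: .num :: .num :: .num :: .num :: .num :: .num :: Γ)
      ([.num, .num, .num, .num] :: Δ))
    (hψ : ∀ X z (k d p₁ p₂ b' c' : Fin (Nat.card V + 1)),
      ψ.Realize (.cons (s := .elem) z <| .cons (s := .num) k <| .cons (s := .num) d <|
        .cons (s := .num) p₁ <| .cons (s := .num) p₂ <| .cons (s := .num) b' <|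
        .cons (s := .num) c' e) (.cons X r) ↔
      (f z).testBit (p₁ * (Nat.card V + 1) + p₂) = true) (i j b c : Var Γ .num) :
    (carryRel ψ i j b c).Realize e r ↔
      column f (e.pos i j) + carry f (e.pos i j) = 2 * e.val c + e.val b ∧ e.val b ≤ 1 := by
  simp only [carryRel]
  rw [Realize, inflFix_iff_of_rank
    (P := fun x => column f (x.pos v₀ v₁) + carry f (x.pos v₀ v₁) = 2 * x.val v₃ + x.val v₂ ∧
      x.val v₂ ≤ 1)
    (fun x => x.pos v₀ v₁)]
  · simp [Terms.value, Term.value, Env.val, Env.pos]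
  · intro s X hX x
    rcases x with _ | ⟨i, _ | ⟨j, _ | ⟨b, _ | ⟨c, _ | _⟩⟩⟩⟩
    change Fin (Nat.card V + 1) at i j b c
    have hcount : ∀ k d : Fin (Nat.card V + 1),
        (Term.count ψ).value (.cons (s := .num) k <| .cons (s := .num) d <|
          .cons (s := .num) i <| .cons (s := .num) j <| .cons (s := .num) b <|
          .cons (s := .num) c e) (.cons X r) =
        (⟨column f (i * (Nat.card V + 1) + j), Nat.lt_succ_of_le (Finite.card_subtype_le _)⟩ :
          Fin (Nat.card V + 1)) := fun k d => by
      simp only [Term.value, hψ]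
      rfl
    have hcol : column f (i * (Nat.card V + 1) + j) ≤ Nat.card V := Finite.card_subtype_le _
    simp only [realize_or, realize_and, realize_ex_num, realize_isZero, realize_isNext,
      realize_halfSum, Env.cons_append, Env.nil_append, Env.val_zero, Env.val_succ, Env.pos]
    simp only [Realize, RelEnv.get_zero, Terms.value, Term.value_var, hX, Env.val_zero,
      Env.val_succ, Env.get_zero, Env.get_succ, Env.pos, hcount]
    have hi := i.isLt
    have hj := j.isLt
    generalize hp : i.val * (Nat.card V + 1) + j.val = p at *
    constructor
    · rintro ⟨d, _, k, _, hk, ⟨h1, hb⟩, h⟩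
      obtain rfl : k = column f p := congrArg Fin.val hk
      rcases h with ⟨hi, hj, rfl⟩ | ⟨b', _, q₂, _, q₁, _, hq, ⟨hq', hb'⟩, hs⟩
      · obtain rfl : p = 0 := by simp [← hp, hi, hj]
        rw [carry_zero]
        omega
      · subst hq
        rw [carry_succ]
        omega
    · rintro ⟨⟨h1, hb⟩, hs⟩
      have hle := carry_le f p
      refine ⟨carry f p, by omega, column f p, by omega, rfl, ⟨by omega, hb⟩, ?_⟩
      rcases Nat.eq_zero_or_pos p with rfl | h0
      · obtain ⟨h0, hj0⟩ := Nat.add_eq_zero_iff.1 hp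
        exact .inl ⟨(Nat.mul_eq_zero.1 h0).resolve_right (Nat.succ_ne_zero _), hj0, carry_zero f⟩
      · obtain ⟨q, rfl⟩ := Nat.exists_eq_succ_of_ne_zero h0.ne'
        have hq : q / (Nat.card V + 1) * (Nat.card V + 1) + q % (Nat.card V + 1) = q :=
          Nat.div_add_mod' q _
        have hlt : q / (Nat.card V + 1) < Nat.card V + 1 := by
          rw [Nat.div_lt_iff_lt_mul (Nat.succ_pos _)]
          nlinarith
        -- A positive position exists only if `V` is nonempty, so that the digit of the preceding
        -- column is a member of the number domain.
        have hV : 0 < Nat.card V := by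
          by_contra h
          have h0 : Nat.card V = 0 := by omega
          simp only [h0] at hp hi hj
          omega
        refine .inr ⟨(column f q + carry f q) % 2, by omega, q % (Nat.card V + 1),
          Nat.mod_lt _ (Nat.succ_pos _), q / (Nat.card V + 1), hlt, ?_⟩
        rw [hq, carry_succ]
        omega

/-- If `ψ(z, p₁, p₂)` says that the digit at position `(p₁, p₂)` of a number `f z` is `1`, then
`sumDigit ψ i j` says that the digit at position `(i, j)` of the sum of all the numbers `f z` is
`1`. In `ψ`, the variable `z` is followed by two auxiliary variables, by `p₁` and `p₂`, and by four
more auxiliary variables. -/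
def sumDigit (ψ : Formula L (.elem :: .num :: .num :: .num :: .num :: .num :: .num :: .num ::
    .num :: Γ) ([.num, .num, .num, .num] :: Δ)) (i j : Var Γ .num) : Formula L Γ Δ :=
  .ex .num <| .ex .num <| .and (.neg (isZero v₀)) (carryRel ψ i.succ.succ j.succ.succ v₀ v₁)

theorem realize_sumDigit (e : Env V Γ) (r : RelEnv V Δ) (f : V → ℕ)
    (ψ : Formula L (.elem :: .num :: .num :: .num :: .num :: .num :: .num :: .num :: .num :: Γ)
      ([.num, .num, .num, .num] :: Δ))
    (hψ : ∀ X z (k d p₁ p₂ b' c' b c : Fin (Nat.card V + 1)),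
      ψ.Realize (.cons (s := .elem) z <| .cons (s := .num) k <| .cons (s := .num) d <|
        .cons (s := .num) p₁ <| .cons (s := .num) p₂ <| .cons (s := .num) b' <|
        .cons (s := .num) c' <| .cons (s := .num) b <| .cons (s := .num) c e) (.cons X r) ↔
      (f z).testBit (p₁ * (Nat.card V + 1) + p₂) = true) (i j : Var Γ .num) :
    (sumDigit ψ i j).Realize e r ↔ (∑ z, f z).testBit (e.pos i j) = true := by
  have hcol : column f (e.pos i j) ≤ Nat.card V := Finite.card_subtype_le _
  have hcar := carry_le f (e.pos i j)
  simp only [sumDigit, realize_ex_num, realize_and, realize_neg, realize_isZero, testBit_sum]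
  have key := fun (c b : Fin (Nat.card V + 1)) => realize_carryRel
    (.cons (s := .num) b <| .cons (s := .num) c e) r f ψ
    (fun X z k d p₁ p₂ b' c' => hψ X z k d p₁ p₂ b' c' b c) i.succ.succ j.succ.succ v₀ v₁
  simp only [key, Env.pos, Env.val_succ, Env.val_zero]
  rw [← Env.pos]
  constructor
  · rintro ⟨c, _, b, _, h⟩
    omega
  · intro h
    -- A digit `1` requires `V` to be nonempty, so that `1` is a member of the number domain.
    exact ⟨(column f (e.pos i j) + carry f (e.pos i j)) / 2, by omega, 1, by omega, by omega⟩

end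

/-! ### Counting walks -/

/-- A formula with two free element variables, given in every context. -/
abbrev EdgeFormula (L : FirstOrder.Language.{0, 0}) : Type :=
  ∀ {Γ : List Srt} {Δ : List (List Srt)}, Var Γ .elem → Var Γ .elem → Formula L Γ Δ

/-- One summand of the recursion for walks: `x z` is an edge and, in the relation variable `X` of
`walkRel`, the digit at position `(p₁, p₂)` for the walks of length `l` from `z` to `y` is `1`. The
context lists `z`, two auxiliary variables, `p₁`, `p₂`, five auxiliary variables, `l`, one more
auxiliary variable, `x` and `y`. -/
def walkSummand (E : EdgeFormula L) :
    Formula L (.elem :: .num :: .num :: .num :: .num :: .num :: .num :: .num :: .num :: .num ::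
      .num :: .num :: .elem :: .elem :: Γ)
      ([.num, .num, .num, .num] :: [.num, .elem, .elem, .num, .num, .num] :: Δ) :=
  .and (E (.succ <| .succ <| .succ v₉) v₀)
    (.ex .num <| .and (.neg (isZero v₀)) <|
      .relVar v₁ (.cons (.var (.succ <| .succ v₉)) (.cons (.var v₁)
        (.cons (.var (.succ <| .succ <| .succ <| .succ <| .succ v₉))
        (.cons (.var v₄) (.cons (.var v₅) (.cons (.var v₀) .nil)))))))

/-- The relation of all `(l, x, y, i, j, b)` such that `b = 0` or the digit at position `(i, j)` of
the number of walks of length `l` from `x` to `y` is `1`. The tuples with `b ≠ 0` carry the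
information; those with `b = 0` show, in the induction on `l`, that the numbers for `l` have been
computed. -/
def walkRel (E : EdgeFormula L) (l : Var Γ .num) (x y : Var Γ .elem) (i j b : Var Γ .num) :
    Formula L Γ Δ :=
  .ifp [.num, .elem, .elem, .num, .num, .num]
    (.or
      (.and (isZero v₀) (.or (isZero v₅) (.and (varEq v₁ v₂) (.and (isZero v₃) (isZero v₄)))))
      (.ex .num <| .ex .num <| .and (isSucc v₁ v₂) <| .and
        (.and (isZero v₀) (.relVar v₀ (.cons (.var v₁) (.cons (.var v₃) (.cons (.var v₄)
          (.cons (.var v₅) (.cons (.var v₆) (.cons (.var v₀) .nil))))))))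
        (.or (isZero v₇) (sumDigit (walkSummand E) v₅ v₆))))
    (.cons (.var l) (.cons (.var x) (.cons (.var y)
      (.cons (.var i) (.cons (.var j) (.cons (.var b) .nil))))))

/-- The digit at position `(i, j)` of the number of walks of length `l` from `x` to `y` is `1`. -/
def walkDigit (E : EdgeFormula L) (l : Var Γ .num) (x y : Var Γ .elem) (i j : Var Γ .num) :
    Formula L Γ Δ :=
  .ex .num <| .and (.neg (isZero v₀)) (walkRel E l.succ x.succ y.succ i.succ j.succ v₀)

/-- The digit at position `(i, j)` of the number of closed walks of length `l` is `1`. -/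
def closedWalkDigit (E : EdgeFormula L) (l i j : Var Γ .num) : Formula L Γ Δ :=
  sumDigit (walkDigit E (.succ <| .succ <| .succ <| .succ <| .succ <| .succ <| .succ <| .succ <|
    .succ l) v₀ v₀ v₃ v₄) i j

section
variable {V : Type} [L.Structure V] [Fintype V]

/-- `E` defines the adjacency of `G`. -/
def DefinesAdj (E : EdgeFormula L) (G : SimpleGraph V) : Prop :=
  ∀ {Γ Δ} (x y : Var Γ .elem) (e : Env V Γ) (r : RelEnv V Δ),
    (E x y).Realize e r ↔ G.Adj (e.get x) (e.get y)

variable {E : EdgeFormula L} {G : SimpleGraph V}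

open Classical in
/-- The recursion step for walks: if `X` is correct for the length `l'`, the formula gives the digits
for `l' + 1`. -/
theorem realize_sumDigit_walkSummand (hE : DefinesAdj E G) (e : Env V Γ) (r : RelEnv V Δ)
    (l' m l : Fin (Nat.card V + 1)) (x y : V)
    (X : Env V [.num, .elem, .elem, .num, .num, .num] → Prop)
    (hX : ∀ (z : V) (i j b : Fin (Nat.card V + 1)),
      X (.cons (s := .num) l' <| .cons (s := .elem) z <| .cons (s := .elem) y <|
        .cons (s := .num) i <| .cons (s := .num) j <| .cons (s := .num) b .nil) ↔
      b.val = 0 ∨ (walkCount G l' z y).testBit (i * (Nat.card V + 1) + j) = true)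
    (i j : Var Γ .num) :
    (sumDigit (walkSummand E) i.succ.succ.succ.succ.succ j.succ.succ.succ.succ.succ).Realize
      (.cons (s := .num) m <| .cons (s := .num) l' <| .cons (s := .num) l <|
        .cons (s := .elem) x <| .cons (s := .elem) y e) (.cons X r) ↔
    (walkCount G (l' + 1) x y).testBit (e.pos i j) = true := by
  rw [realize_sumDigit _ _ (fun z => if G.Adj x z then walkCount G l' z y else 0), walkCount_succ]
  · rfl
  · intro Y z k d p₁ p₂ b' c' b c
    rw [walkSummand, realize_and, hE]
    simp only [realize_ex_num, realize_and, realize_neg, realize_isZero]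
    simp only [Realize, RelEnv.get_zero, RelEnv.get_succ, Terms.value, Term.value_var, hX,
      Env.val_zero, Env.get_zero, Env.get_succ]
    have : Nonempty V := ⟨z⟩
    have hV : 0 < Nat.card V := Nat.card_pos
    by_cases hadj : G.Adj x z
    · rw [if_pos hadj]
      exact ⟨fun ⟨_, o, _, h, h'⟩ => h'.resolve_left h,
        fun h => ⟨hadj, 1, by omega, Nat.one_ne_zero, .inr h⟩⟩
    · rw [if_neg hadj]
      simp [hadj]

theorem realize_walkRel (hE : DefinesAdj E G)
    (e : Env V Γ) (r : RelEnv V Δ) (l : Var Γ .num) (x y : Var Γ .elem) (i j b : Var Γ .num) :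
    (walkRel E l x y i j b).Realize e r ↔ e.val b = 0 ∨
      (walkCount G (e.val l) (e.get x) (e.get y)).testBit (e.pos i j) = true := by
  classical
  simp only [walkRel]
  rw [Realize, inflFix_iff_of_rank
    (P := fun x => x.val v₅ = 0 ∨
      (walkCount G (x.val v₀) (x.get v₁) (x.get v₂)).testBit (x.pos v₃ v₄) = true)
    (fun x => x.val v₀)]
  · simp [Terms.value, Term.value, Env.val, Env.pos]
  · intro s X hX x
    rcases x with _ | ⟨l, _ | ⟨x, _ | ⟨y, _ | ⟨i, _ | ⟨j, _ | ⟨b, _ | _⟩⟩⟩⟩⟩⟩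
    change Fin (Nat.card V + 1) at l i j b
    change V at x y
    have key : ∀ l' m : Fin (Nat.card V + 1), l'.val < s → _ := fun l' m hl' =>
      realize_sumDigit_walkSummand hE
        (.cons (s := .num) i <| .cons (s := .num) j <| .cons (s := .num) b e) r l' m l x y X
        (fun z i j b => by simp [hX, hl', Env.pos]) v₀ v₁
    simp only [realize_or, realize_and, realize_ex_num, realize_isZero, realize_isSucc,
      realize_varEq_elem, Env.cons_append, Env.nil_append, Env.val_zero, Env.val_succ, Env.pos]
    have hl := l.isLt
    constructor
    · rintro (⟨hl0, h⟩ | ⟨l', hl', m, hm, hs, ⟨hm0, hr⟩, h⟩)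
      · refine ⟨h.imp_right fun ⟨h, hi, hj⟩ => ?_, by omega⟩
        simp_all [walkCount_zero]
      · simp only [Realize, RelEnv.get_zero, hX, Terms.value, Term.value_var, Env.val_zero,
          Env.get_zero, Env.get_succ] at hr
        refine ⟨h.imp_right fun h => ?_, by omega⟩
        rw [hs]
        exact (key ⟨l', hl'⟩ ⟨m, hm⟩ hr.2).1 h
    · rintro ⟨h, hs⟩
      rcases Nat.eq_zero_or_pos l.val with h0 | h0
      · refine .inl ⟨h0, h.imp_right fun h => ?_⟩
        simp only [h0, Env.get_succ, Env.get_zero, walkCount_zero] at h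
        by_cases hxy : x = y
        · rw [if_pos hxy, Nat.testBit_one_eq_true_iff_self_eq_zero] at h
          have := Nat.add_eq_zero_iff.1 h
          exact ⟨hxy, (Nat.mul_eq_zero.1 this.1).resolve_right (Nat.succ_ne_zero _), this.2⟩
        · simp [hxy] at h
      · -- The tuple with last entry `0` shows that the length `l - 1` has been dealt with.
        refine .inr ⟨l - 1, by omega, 0, Nat.succ_pos _, by omega, ⟨rfl, ?_⟩,
          h.imp_right fun h => ?_⟩
        · simp only [Realize, RelEnv.get_zero, hX, Terms.value, Term.value_var, Env.val_zero,
            Env.val_succ, Env.get_zero, Env.get_succ]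
          exact ⟨.inl trivial, by omega⟩
        · refine (key ⟨l - 1, by omega⟩ 0 (by simp; omega)).2 ?_
          rw [show l.val = l.val - 1 + 1 by omega] at h
          exact h

theorem realize_walkDigit (hE : DefinesAdj E G) (e : Env V Γ) (r : RelEnv V Δ)
    (l : Var Γ .num) (x y : Var Γ .elem) (i j : Var Γ .num) :
    (walkDigit E l x y i j).Realize e r ↔
      (walkCount G (e.val l) (e.get x) (e.get y)).testBit (e.pos i j) = true := by
  -- Since there is a vertex, `1` is a member of the number domain and can serve as the last entry.
  have : Nonempty V := ⟨e.get x⟩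
  have hV : 0 < Nat.card V := Nat.card_pos
  simp only [walkDigit, realize_ex_num, realize_and, realize_neg, realize_isZero,
    realize_walkRel hE, Env.val_zero, Env.val_succ, Env.get_succ, Env.pos]
  exact ⟨fun ⟨o, _, h, h'⟩ => h'.resolve_left h, fun h => ⟨1, by omega, Nat.one_ne_zero, .inr h⟩⟩

theorem realize_closedWalkDigit (hE : DefinesAdj E G) (e : Env V Γ) (r : RelEnv V Δ)
    (l i j : Var Γ .num) :
    (closedWalkDigit E l i j).Realize e r ↔
      (closedWalkCount G (e.val l)).testBit (e.pos i j) = true := by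
  rw [closedWalkDigit, realize_sumDigit _ _ fun z => walkCount G (e.val l) z z,
    closedWalkCount_eq_sum]
  intro X z k d p₁ p₂ b' c' b c
  rw [realize_walkDigit hE]
  rfl

/-- Pairs of numbers stand for all positions below `(n + 1) * (n + 1)`, and the number of closed
walks has no digit `1` beyond those. -/
theorem exists_pos_of_testBit_closedWalkCount {l : ℕ} (hl : l ≤ Nat.card V) {p : ℕ}
    (hp : (closedWalkCount G l).testBit p = true) :
    ∃ i j : Fin (Nat.card V + 1), p = i * (Nat.card V + 1) + j := by
  have hlt : p < (Nat.card V + 1) * (Nat.card V + 1) := by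
    by_contra h
    have := Nat.testBit_lt_two_pow ((closedWalkCount_lt G hl).trans_le
      (Nat.pow_le_pow_right Nat.two_pos (not_lt.1 h)))
    simp [this] at hp
  exact ⟨⟨p / (Nat.card V + 1), Nat.div_lt_of_lt_mul hlt⟩,
    ⟨p % (Nat.card V + 1), Nat.mod_lt _ (Nat.succ_pos _)⟩, (Nat.div_add_mod' p _).symm⟩

end

/-! ### Co-spectrality -/

/-- The binary relation symbol `R` as an edge formula. -/
def relEdge (R : L.Relations 2) : EdgeFormula L := fun x y => .rel R ![.var x, .var y]

theorem definesAdj_relEdge {V : Type} [L.Structure V] [Fintype V] {R : L.Relations 2}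
    {G : SimpleGraph V} (h : ∀ v : Fin 2 → V, FirstOrder.Language.Structure.RelMap R v ↔
      G.Adj (v 0) (v 1)) : DefinesAdj (relEdge R) G := by
  intro Γ Δ x y e r
  simp only [relEdge, Realize]
  rw [h]
  simp

/-- The closed walks of length `l` with respect to `E` and to `E'` are equal in number, for every
`l ≤ n`. -/
def sameClosedWalks (E E' : EdgeFormula L) : Sentence L :=
  .all .num <| .all .num <| .all .num <|
    .or (.and (closedWalkDigit E v₀ v₁ v₂) (closedWalkDigit E' v₀ v₁ v₂))
      (.and (.neg (closedWalkDigit E v₀ v₁ v₂)) (.neg (closedWalkDigit E' v₀ v₁ v₂)))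

theorem realize_sameClosedWalks {V : Type} [L.Structure V] [Fintype V] {E E' : EdgeFormula L}
    {G G' : SimpleGraph V} (hE : DefinesAdj E G) (hE' : DefinesAdj E' G') :
    (sameClosedWalks E E').Realize (V := V) .nil .nil ↔ Cospectral G G' := by
  rw [cospectral_iff_closedWalkCount_eq]
  simp only [sameClosedWalks, realize_all_num, realize_or, realize_and, realize_neg,
    realize_closedWalkDigit hE, realize_closedWalkDigit hE', Env.val_zero, Env.val_succ, Env.pos,
    ← iff_iff_and_or_not_and_not]
  constructor
  · intro h l hl
    refine Nat.eq_of_testBit_eq fun p => Bool.eq_iff_iff.2 ?_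
    have key := fun i j : Fin (Nat.card V + 1) =>
      h j j.isLt i i.isLt l (Nat.lt_succ_of_le hl)
    constructor
    · intro hp
      obtain ⟨i, j, rfl⟩ := exists_pos_of_testBit_closedWalkCount hl hp
      exact (key i j).1 hp
    · intro hp
      obtain ⟨i, j, rfl⟩ := exists_pos_of_testBit_closedWalkCount hl hp
      exact (key i j).2 hp
  · intro h j _ i _ l hl
    rw [h l (Nat.le_of_lt_succ hl)]

end Formula

end FPC

open FPC in
theorem mainTheorem3 :
    (∃ φ : FPC.Formula FirstOrder.Language.graph [FPC.Srt.num, FPC.Srt.num, FPC.Srt.num] [],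
      ∀ (V : Type) [Fintype V] (G : SimpleGraph V) (l : Fin (Nat.card V + 1)),
        FPC.BinaryEncodes (fun i j => FPC.HoldsInGraph φ G l i j)
          (FPC.closedWalkCount G (l : ℕ))) ∧
    (∃ cospec : FPC.Sentence FPC.graphPairLanguage,
      ∀ (V : Type) [Fintype V] (G G' : SimpleGraph V),
        FPC.HoldsInPair cospec G G' ↔ FPC.Cospectral G G') := by
  refine ⟨⟨Formula.closedWalkDigit (Formula.relEdge FirstOrder.Language.adj) .zero
    (.succ .zero) (.succ (.succ .zero)), fun V _ G l p => ?_⟩,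
    ⟨Formula.sameClosedWalks (Formula.relEdge GraphPairRel.E) (Formula.relEdge GraphPairRel.E'),
      fun V _ G G' => ?_⟩⟩
  · let := G.structure
    have hE : Formula.DefinesAdj (Formula.relEdge FirstOrder.Language.adj) G :=
      Formula.definesAdj_relEdge fun _ => Iff.rfl
    have key := fun i j : Fin (Nat.card V + 1) => Formula.realize_closedWalkDigit hE
      (.cons (s := .num) l <| .cons (s := .num) i <| .cons (s := .num) j .nil) .nil
      .zero (.succ .zero) (.succ (.succ .zero))
    constructor
    · intro hp
      obtain ⟨i, j, rfl⟩ := Formula.exists_pos_of_testBit_closedWalkCount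
        (Nat.le_of_lt_succ l.isLt) hp
      exact ⟨i, j, rfl, (key i j).2 hp⟩
    · rintro ⟨i, j, rfl, h⟩
      exact (key i j).1 h
  · let := graphPairStructure G G'
    exact Formula.realize_sameClosedWalks (Formula.definesAdj_relEdge fun _ => Iff.rfl)
      (Formula.definesAdj_relEdge fun _ => Iff.rfl)
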